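/- Let $p$ be a prime, $q$ a power of $p$, and let $\mathbb{F}_q(t)\langle\partial\rangle$ be the ring of linear differential operators $\sum_i f_i\partial^i$, $f_i\in\mathbb{F}_q(t)$, with $\partial f=f\partial+\frac{\mathrm{d}f}{\mathrm{d}t}$. For a nonzero operator $L$ put $\mathcal{D}_L=\mathbb{F}_q(t)\langle\partial\rangle/\mathbb{F}_q(t)\langle\partial\rangle L$, and let its $p$-curvature $\psi_p^L$ be the $\mathbb{F}_q(t)$-linear endomorphism of $\mathcal{D}_L$ given by multiplication by $\partial^p$. The Frobenius invariants of $\psi_p^L$ are the nonconstant monic polynomials $P_1\mid P_2\mid\dots\mid P_m$ such that $\mathcal{D}_L\simeq\bigoplus_{i=1}^m\mathbb{F}_q(t)[Y]/(P_i)$ as $\mathbb{F}_q(t)[Y]$-modules, where $Y$ acts on $\mathcal{D}_L$ as $\psi_p^L$. We write $L=\mathrm{LCLM}(L_1,L_2)$ if $\mathbb{F}_q(t)\langle\partial\rangle L=\mathbb{F}_q(t)\langle\partial\rangle L_1\cap\mathbb{F}_q(t)\langle\partial\rangle L_2$. **Lemma.** Let $L\in\mathbb{F}_q(t)\langle\partial\rangle$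 be nonzero and such that every irreducible factor over $\mathbb{F}_q(t^p)$ of the characteristic polynomial $\chi(\psi_p^L)$ is separable. Let $P_1\mid\dots\mid P_m$ be the Frobenius invariants of $\psi_p^L$. Let $N\in\mathbb{F}_q(t^p)[Y]$ be irreducible and separable over $\mathbb{F}_q(t^p)$, let $\nu\ge 0$ be the largest integer such that the central operator $N(\partial^p)^\nu$ divides $L$, and let $\nu_N$ denote the $N$-adic valuation on $\mathbb{F}_q(t^p)[Y]$. Then the $P_i$ have coefficients in $\mathbb{F}_q(t^p)$, and: 1. $m\le p$. 2. If $\nu>0$, then $m=p$ and $\nu_N(P_1)=\nu$. 3. If $\nu_N(P_p)=\nu$ (a condition regarded as void if $m<p$, in which case $\nu=0$ by 2), then $L=\mathrm{LCLM}\bigl(L\cdot N(\partial^p)^{-\nu},\,N(\partial^p)^{\nu}\bigr)$, where $L\cdot N(\partial^p)^{-\nu}$ is the operator $L'$ with $L=L'\,N(\partial^p)^{\nu}$. -/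

import Mathlib

open Polynomial
open scoped Differential

noncomputable section

/-- A differential ring from an additive map satisfying the Leibniz rule. -/
abbrev Differential.ofFun {R : Type*} [CommRing R] (d : R → R) (hadd : ∀ f g, d (f + g) = d f + d g)
    (hmul : ∀ f g, d (f * g) = f * d g + g * d f) : Differential R where
  deriv := Derivation.mk' (AddMonoidHom.mk' d hadd).toIntLinearMap hmul

/-! ### The derivation `d/dt` of the rational function field `k(t)` -/

namespace RatFunc

variable {k : Type*} [Field k]

/-- The derivative of a rational function, by the quotient rule. -/
def ddt (f : RatFunc k) : RatFunc k :=
  (algebraMap k[X] (RatFunc k) (derivative f.num) * algebraMap k[X] (RatFunc k) f.denom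
    - algebraMap k[X] (RatFunc k) f.num * algebraMap k[X] (RatFunc k) (derivative f.denom))
    / (algebraMap k[X] (RatFunc k) f.denom) ^ 2

theorem algebraMap_ne_zero' {b : k[X]} (hb : b ≠ 0) : algebraMap k[X] (RatFunc k) b ≠ 0 := by
  simpa using hb

theorem ddt_div (a b : k[X]) (hb : b ≠ 0) :
    ddt (algebraMap k[X] (RatFunc k) a / algebraMap k[X] (RatFunc k) b)
      = algebraMap k[X] (RatFunc k) (derivative a * b - a * derivative b)
        / (algebraMap k[X] (RatFunc k) b) ^ 2 := by
  set f := algebraMap k[X] (RatFunc k) a / algebraMap k[X] (RatFunc k) b with hf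
  have hb' := algebraMap_ne_zero' hb
  have hd : f.denom ≠ 0 := f.denom_ne_zero
  have hd' := algebraMap_ne_zero' hd
  have h1 : algebraMap k[X] (RatFunc k) (a * f.denom) = algebraMap k[X] (RatFunc k) (f.num * b) := by
    have h2 : algebraMap k[X] (RatFunc k) f.num / algebraMap k[X] (RatFunc k) f.denom
        = algebraMap k[X] (RatFunc k) a / algebraMap k[X] (RatFunc k) b := by
      rw [num_div_denom]
    rw [div_eq_div_iff hd' hb'] at h2
    rw [map_mul, map_mul, h2]
  have h3 : a * f.denom = f.num * b := algebraMap_injective k h1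
  have h4 : derivative a * f.denom + a * derivative f.denom
      = derivative f.num * b + f.num * derivative b := by
    rw [← derivative_mul, ← derivative_mul, h3]
  unfold ddt
  rw [div_eq_div_iff (pow_ne_zero 2 hd') (pow_ne_zero 2 hb'), ← map_mul, ← map_mul, ← map_sub,
    ← map_pow, ← map_pow, ← map_mul, ← map_mul]
  congr 1
  linear_combination (-(b * f.denom)) * h4 + (derivative b * f.denom + b * derivative f.denom) * h3

theorem exists_div (f : RatFunc k) : ∃ a b : k[X], b ≠ 0 ∧
    f = algebraMap k[X] (RatFunc k) a / algebraMap k[X] (RatFunc k) b :=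
  ⟨f.num, f.denom, f.denom_ne_zero, (num_div_denom f).symm⟩

theorem ddt_add (f g : RatFunc k) : ddt (f + g) = ddt f + ddt g := by
  obtain ⟨a, b, hb, rfl⟩ := exists_div f
  obtain ⟨c, e, he, rfl⟩ := exists_div g
  have hb' := algebraMap_ne_zero' hb
  have he' := algebraMap_ne_zero' he
  rw [div_add_div _ _ hb' he', ← map_mul, ← map_mul, ← map_mul, ← map_add,
    ddt_div _ _ (mul_ne_zero hb he), ddt_div _ _ hb, ddt_div _ _ he]
  simp only [derivative_mul, map_add, map_sub, map_mul]
  field_simp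
  ring

theorem ddt_mul (f g : RatFunc k) : ddt (f * g) = f * ddt g + g * ddt f := by
  obtain ⟨a, b, hb, rfl⟩ := exists_div f
  obtain ⟨c, e, he, rfl⟩ := exists_div g
  have hb' := algebraMap_ne_zero' hb
  have he' := algebraMap_ne_zero' he
  rw [div_mul_div_comm, ← map_mul, ← map_mul,
    ddt_div _ _ (mul_ne_zero hb he), ddt_div _ _ hb, ddt_div _ _ he]
  simp only [derivative_mul, map_add, map_sub, map_mul]
  field_simp
  ring

/-- `k(t)` as a differential field, with derivation `d/dt`. -/
instance instDifferential : Differential (RatFunc k) :=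
  Differential.ofFun ddt ddt_add ddt_mul

theorem deriv_eq_ddt (f : RatFunc k) : f′ = ddt f := rfl

theorem ddt_algebraMap (a : k[X]) :
    ddt (algebraMap k[X] (RatFunc k) a) = algebraMap k[X] (RatFunc k) (derivative a) := by
  simpa using ddt_div a 1 one_ne_zero

theorem iterate_ddt_algebraMap (a : k[X]) (n : ℕ) :
    ddt^[n] (algebraMap k[X] (RatFunc k) a) = algebraMap k[X] (RatFunc k) (derivative^[n] a) := by
  induction n with
  | zero => rfl
  | succ n ih => rw [Function.iterate_succ_apply', Function.iterate_succ_apply', ih,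
      ddt_algebraMap]

/-- In characteristic `p`, the `p`-th iterate of `d/dt` vanishes on `k(t)`. -/
theorem iterate_ddt_char (p : ℕ) [Fact p.Prime] [CharP k p] (f : RatFunc k) :
    ddt^[p] f = 0 := by
  obtain ⟨a, b, hb, rfl⟩ := exists_div f
  have hp : p ≠ 0 := (Fact.out : p.Prime).ne_zero
  have hb' := algebraMap_ne_zero' hb
  have hpoly : ∀ c : k[X], derivative^[p] c = 0 := by
    intro c
    rw [Polynomial.iterate_derivative_eq_factorial_smul_sum]
    ext i
    rw [coeff_smul, nsmul_eq_mul, (CharP.cast_eq_zero_iff k p _).2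
      ((Fact.out : p.Prime).dvd_factorial.2 le_rfl), zero_mul, coeff_zero]
  set g : RatFunc k := ((algebraMap k[X] (RatFunc k) b) ^ p)⁻¹ with hg
  have hgd : ddt g = 0 := by
    have h1 : ddt ((algebraMap k[X] (RatFunc k) b) ^ p) = 0 := by
      rw [← map_pow, ddt_algebraMap, derivative_pow]
      simp [CharP.cast_eq_zero]
    have h2 : ddt (((algebraMap k[X] (RatFunc k) b) ^ p) * g) = 0 := by
      rw [hg, mul_inv_cancel₀ (pow_ne_zero _ hb')]
      simpa using ddt_algebraMap (k := k) 1
    rw [ddt_mul, h1, mul_zero, add_zero] at h2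
    exact (mul_eq_zero.1 h2).resolve_left (pow_ne_zero _ hb')
  have hlin : ∀ (n : ℕ) (h : RatFunc k), ddt^[n] (g * h) = g * ddt^[n] h := by
    intro n
    induction n with
    | zero => intro h; rfl
    | succ n ih =>
      intro h
      rw [Function.iterate_succ_apply, Function.iterate_succ_apply, ← ih, ddt_mul, hgd, mul_zero,
        add_zero]
  have hrw : algebraMap k[X] (RatFunc k) a / algebraMap k[X] (RatFunc k) b
      = g * algebraMap k[X] (RatFunc k) (a * b ^ (p - 1)) := by
    rw [hg, map_mul, map_pow]
    obtain ⟨q, rfl⟩ := Nat.exists_eq_succ_of_ne_zero hp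
    simp only [Nat.succ_eq_add_one, Nat.add_sub_cancel, pow_succ]
    field_simp
  rw [hrw, hlin, iterate_ddt_algebraMap, hpoly, map_zero, mul_zero]

end RatFunc

/-! ### The ring of differential operators `K⟨∂⟩` -/

/-- The ring `K⟨∂⟩` of linear differential operators over a differential field `K`: its elements
are the polynomials `∑ fᵢ ∂ⁱ` in `∂` with coefficients (on the left) in `K`; the variable of the
underlying polynomial stands for `∂`. -/
def DiffOp (K : Type*) [Field K] [Differential K] : Type _ := K[X]

namespace DiffOp

variable {K : Type*} [Field K] [Differential K]

instance : AddCommGroup (DiffOp K) := inferInstanceAs (AddCommGroup K[X])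

instance : Module K (DiffOp K) := inferInstanceAs (Module K K[X])

/-- Left multiplication by `∂`: since `∂ f = f ∂ + f′`, it sends `∑ fᵢ ∂ⁱ` to
`∑ fᵢ′ ∂ⁱ + ∑ fᵢ ∂ⁱ⁺¹`. -/
def dMul (M : K[X]) : K[X] := Differential.mapCoeffs M + X * M

/-- The product of differential operators, `(∑ fᵢ ∂ⁱ) M = ∑ fᵢ (∂ (∂ (⋯ (∂ M))))`. -/
def mulAux (L M : K[X]) : K[X] := L.sum fun i f => C f * dMul^[i] M

theorem dMul_add (M N : K[X]) : dMul (M + N) = dMul M + dMul N := by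
  simp only [dMul, map_add, mul_add]; abel

theorem dMul_zero : dMul (0 : K[X]) = 0 := by simp [dMul]

theorem dMul_C_mul (f : K) (M : K[X]) : dMul (C f * M) = C f * dMul M + C f′ * M := by
  simp only [dMul, Derivation.leibniz, Differential.mapCoeffs_C, smul_eq_mul]; ring

theorem iterate_dMul_add (n : ℕ) (M N : K[X]) :
    dMul^[n] (M + N) = dMul^[n] M + dMul^[n] N := by
  induction n with
  | zero => rfl
  | succ n ih => simp only [Function.iterate_succ_apply', ih, dMul_add]

theorem iterate_dMul_one (n : ℕ) : dMul^[n] (1 : K[X]) = X ^ n := by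
  induction n with
  | zero => simp
  | succ n ih =>
    rw [Function.iterate_succ_apply', ih, dMul, Derivation.leibniz_pow,
      Differential.mapCoeffs_X]
    simp [pow_succ']

theorem mulAux_add_left (L L' M : K[X]) : mulAux (L + L') M = mulAux L M + mulAux L' M := by
  unfold mulAux
  rw [sum_add_index] <;> simp [add_mul]

theorem mulAux_add_right (L M N : K[X]) : mulAux L (M + N) = mulAux L M + mulAux L N := by
  unfold mulAux
  simp only [iterate_dMul_add, mul_add, Polynomial.sum_def, Finset.sum_add_distrib]

theorem mulAux_zero_left (M : K[X]) : mulAux 0 M = 0 := by simp [mulAux]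

theorem mulAux_zero_right (L : K[X]) : mulAux L 0 = 0 := by
  simpa using mulAux_add_right L 0 0

theorem mulAux_monomial (n : ℕ) (f : K) (M : K[X]) :
    mulAux (monomial n f) M = C f * dMul^[n] M := by
  unfold mulAux
  rw [sum_monomial_index] <;> simp

theorem mulAux_C (f : K) (M : K[X]) : mulAux (C f) M = C f * M := by
  have h := mulAux_monomial 0 f M
  rwa [monomial_zero_left, Function.iterate_zero_apply] at h

theorem mulAux_C_mul (f : K) (L M : K[X]) : mulAux (C f * L) M = C f * mulAux L M := by
  induction L using Polynomial.induction_on' with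
  | add p q hp hq => rw [mul_add, mulAux_add_left, hp, hq, mulAux_add_left, mul_add]
  | monomial n a => rw [C_mul_monomial, mulAux_monomial, mulAux_monomial, C_mul, mul_assoc]

theorem mulAux_dMul (L M : K[X]) : mulAux (dMul L) M = dMul (mulAux L M) := by
  induction L using Polynomial.induction_on' with
  | add p q hp hq =>
    rw [dMul_add, mulAux_add_left, hp, hq, mulAux_add_left, dMul_add]
  | monomial n a =>
    rw [mulAux_monomial, dMul_C_mul, ← Function.iterate_succ_apply' dMul, dMul,
      Differential.mapCoeffs_monomial, X_mul_monomial, mulAux_add_left, mulAux_monomial,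
      mulAux_monomial, add_comm]

theorem mulAux_iterate_dMul (n : ℕ) (L M : K[X]) :
    mulAux (dMul^[n] L) M = dMul^[n] (mulAux L M) := by
  induction n with
  | zero => rfl
  | succ n ih => simp only [Function.iterate_succ_apply', mulAux_dMul, ih]

theorem mulAux_assoc (L M N : K[X]) : mulAux (mulAux L M) N = mulAux L (mulAux M N) := by
  induction L using Polynomial.induction_on' with
  | add p q hp hq => simp only [mulAux_add_left, hp, hq]
  | monomial n a => rw [mulAux_monomial, mulAux_monomial, mulAux_C_mul, mulAux_iterate_dMul]

theorem mulAux_one_left (M : K[X]) : mulAux 1 M = M := by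
  rw [← monomial_zero_one, mulAux_monomial]; simp

theorem mulAux_one_right (L : K[X]) : mulAux L 1 = L := by
  unfold mulAux
  simp only [iterate_dMul_one, C_mul_X_pow_eq_monomial]
  exact sum_monomial_eq L

instance instRing : Ring (DiffOp K) :=
  { (inferInstance : AddCommGroup (DiffOp K)) with
    mul := mulAux
    one := (1 : K[X])
    mul_assoc := mulAux_assoc
    one_mul := mulAux_one_left
    mul_one := mulAux_one_right
    left_distrib := mulAux_add_right
    right_distrib := mulAux_add_left
    zero_mul := mulAux_zero_left
    mul_zero := mulAux_zero_right }

/-- The polynomial in the symbol `∂` underlying a differential operator. -/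
def toPoly : DiffOp K ≃ₗ[K] K[X] := LinearEquiv.refl K K[X]

theorem toPoly_mul (L M : DiffOp K) : toPoly (L * M) = mulAux (toPoly L) (toPoly M) := rfl

/-- The inclusion of the coefficient field, as operators of order zero. -/
def ofField : K →+* DiffOp K where
  toFun f := (C f : K[X])
  map_one' := C_1
  map_zero' := C_0
  map_add' f g := C_add
  map_mul' f g := by
    change (C (f * g) : K[X]) = mulAux (C f) (C g)
    rw [mulAux_C, C_mul]

/-- The operator `∂`. -/
def del : DiffOp K := (X : K[X])

theorem toPoly_ofField (f : K) : toPoly (ofField f) = C f := rfl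

theorem toPoly_del : toPoly (del : DiffOp K) = X := rfl

theorem ofField_mul (f : K) (M : DiffOp K) : ofField f * M = f • M := by
  apply toPoly.injective
  rw [toPoly_mul, toPoly_ofField, mulAux_C, map_smul, smul_eq_C_mul]

theorem toPoly_del_mul (M : DiffOp K) : toPoly (del * M) = dMul (toPoly M) := by
  rw [toPoly_mul, toPoly_del, ← monomial_one_one_eq_X, mulAux_monomial]; simp

/-- The commutation rule `∂ f = f ∂ + f′`. -/
theorem del_mul_ofField (f : K) :
    (del : DiffOp K) * ofField f = ofField f * del + ofField f′ := by
  apply toPoly.injective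
  rw [toPoly_del_mul, toPoly_ofField, map_add, toPoly_ofField, ofField_mul, map_smul, toPoly_del,
    dMul, Differential.mapCoeffs_C, smul_eq_C_mul]
  ring

theorem toPoly_del_pow_mul (n : ℕ) (M : DiffOp K) :
    toPoly (del ^ n * M) = dMul^[n] (toPoly M) := by
  induction n generalizing M with
  | zero => simp
  | succ n ih => rw [pow_succ, mul_assoc, ih, toPoly_del_mul, Function.iterate_succ_apply]

instance : IsScalarTower K (DiffOp K) (DiffOp K) where
  smul_assoc f L M := by
    rw [smul_eq_mul, smul_eq_mul, ← ofField_mul, ← ofField_mul, mul_assoc]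

/-- The left module `𝒟_L = K⟨∂⟩ / K⟨∂⟩L`. -/
abbrev Quot (L : DiffOp K) : Type _ := DiffOp K ⧸ Submodule.span (DiffOp K) {L}

/-- `L = LCLM(L₁, L₂)`, i.e. `K⟨∂⟩L = K⟨∂⟩L₁ ∩ K⟨∂⟩L₂`. -/
def IsLCLM (L L₁ L₂ : DiffOp K) : Prop :=
  Submodule.span (DiffOp K) {L} = Submodule.span (DiffOp K) {L₁} ⊓ Submodule.span (DiffOp K) {L₂}

/-- `R` is a right divisor of `L`, i.e. `L` is a left multiple `M R` of `R`. -/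
def IsRightDivisor (R L : DiffOp K) : Prop := ∃ M : DiffOp K, L = M * R

theorem natDegree_iterate_dMul (M : K[X]) (n m : ℕ) (hM : M.natDegree ≤ n) :
    (dMul^[m] M).natDegree ≤ n + m ∧ (dMul^[m] M).coeff (n + m) = M.coeff n := by
  induction m with
  | zero => exact ⟨hM, rfl⟩
  | succ m ih =>
    rw [Function.iterate_succ_apply']
    obtain ⟨h1, h2⟩ := ih
    have hz : ∀ j, n + m < j → (dMul^[m] M).coeff j = 0 := fun j hj =>
      coeff_eq_zero_of_natDegree_lt (lt_of_le_of_lt h1 hj)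
    refine ⟨natDegree_le_iff_coeff_eq_zero.2 fun j hj => ?_, ?_⟩
    · obtain ⟨i, rfl⟩ : ∃ i, j = i + 1 := ⟨j - 1, by omega⟩
      rw [dMul, coeff_add, Differential.coeff_mapCoeffs, coeff_X_mul, hz _ (by omega),
        hz _ (by omega), map_zero, add_zero]
    · rw [← add_assoc, dMul, coeff_add, Differential.coeff_mapCoeffs, coeff_X_mul,
        hz _ (by omega), map_zero, zero_add, h2]

/-- The quotient `𝒟_L` is finite dimensional over `K` when `L ≠ 0`. -/
theorem finite_quot (L : DiffOp K) (hL : L ≠ 0) : Module.Finite K (Quot L) := by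
  have hL' : toPoly L ≠ 0 := fun h => hL (toPoly.injective (h.trans (map_zero _).symm))
  set r := (toPoly L).natDegree with hr
  let π : DiffOp K →ₗ[K] Quot L := (Submodule.mkQ (Submodule.span (DiffOp K) {L})).restrictScalars K
  let φ : degreeLT K r →ₗ[K] Quot L :=
    (π.comp (toPoly (K := K)).symm.toLinearMap).comp (degreeLT K r).subtype
  have key : ∀ n : ℕ, ∀ M : K[X], M.natDegree < n → π (toPoly.symm M) ∈ LinearMap.range φ := by
    intro n
    induction n with
    | zero => intro M h; omega
    | succ n ih =>
      intro M hM
      by_cases hlt : n < r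
      · refine ⟨⟨M, mem_degreeLT.2 ?_⟩, rfl⟩
        exact lt_of_le_of_lt degree_le_natDegree (by exact_mod_cast (by omega : M.natDegree < r))
      · push Not at hlt
        obtain ⟨m, rfl⟩ := Nat.exists_eq_add_of_le hlt
        set c : K := M.coeff (r + m) / (toPoly L).leadingCoeff with hc
        set Q : DiffOp K := ofField c * (del ^ m * L) with hQ
        have hQp : toPoly Q = C c * dMul^[m] (toPoly L) := by
          rw [hQ, ofField_mul, map_smul, toPoly_del_pow_mul, smul_eq_C_mul]
        have hQ0 : π Q = 0 := by
          change Submodule.Quotient.mk Q = 0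
          rw [Submodule.Quotient.mk_eq_zero, hQ, ← mul_assoc, Submodule.mem_span_singleton]
          exact ⟨_, rfl⟩
        obtain ⟨h1, h2⟩ := natDegree_iterate_dMul (toPoly L) r m le_rfl
        have hcoef : (M - toPoly Q).coeff (r + m) = 0 := by
          rw [coeff_sub, hQp, coeff_C_mul, h2, hc, hr, coeff_natDegree,
            div_mul_cancel₀ _ (leadingCoeff_ne_zero.2 hL'), sub_self]
        have hle : (M - toPoly Q).natDegree ≤ r + m := by
          refine (natDegree_sub_le _ _).trans (max_le (by omega) ?_)
          rw [hQp]
          exact (natDegree_C_mul_le _ _).trans h1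
        have heq : π (toPoly.symm M) = π (toPoly.symm (M - toPoly Q)) := by
          rw [map_sub, LinearEquiv.symm_apply_apply, map_sub, hQ0, sub_zero]
        rw [heq]
        by_cases hz : r + m = 0
        · have : M - toPoly Q = 0 := by
            rw [hz] at hle hcoef
            rw [eq_C_of_natDegree_le_zero hle, hcoef, C_0]
          rw [this, map_zero, map_zero]
          exact Submodule.zero_mem _
        · apply ih
          refine lt_of_le_of_ne hle fun h => ?_
          rw [← h, coeff_natDegree, leadingCoeff_eq_zero] at hcoef
          rw [hcoef, natDegree_zero] at h
          exact hz h.symm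
  refine Module.Finite.of_surjective φ fun x => ?_
  obtain ⟨M, rfl⟩ := Submodule.Quotient.mk_surjective _ x
  have := key ((toPoly M).natDegree + 1) (toPoly M) (Nat.lt_succ_self _)
  rwa [LinearEquiv.symm_apply_apply] at this

end DiffOp

/-! ### Frobenius invariants of an endomorphism -/

/-- `P 0 ∣ P 1 ∣ ⋯ ∣ P (m - 1)` are the Frobenius invariants (invariant factors) of the
endomorphism `φ` of `V`: they are monic and nonconstant, each divides the next ones, and `V`, on
which the variable of `F[X]` acts through `φ`, is isomorphic to `⨁ᵢ F[X] / (P i)`. -/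
structure IsFrobeniusInvariants {F V : Type*} [Field F] [AddCommGroup V] [Module F V]
    (φ : Module.End F V) {m : ℕ} (P : Fin m → F[X]) : Prop where
  monic : ∀ i, (P i).Monic
  natDegree_pos : ∀ i, 0 < (P i).natDegree
  dvd : ∀ i j, i ≤ j → P i ∣ P j
  equiv : Nonempty (Module.AEval' φ ≃ₗ[F[X]] (∀ i, F[X] ⧸ Ideal.span {P i}))

/-! ### Operators over `k(t)` in characteristic `p`, and their `p`-curvature -/

section CharP

variable (k : Type*) [Field k] (p : ℕ)

/-- The subfield `k(tᵖ)` of `k(t)`. -/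
abbrev FrobField : IntermediateField k (RatFunc k) :=
  IntermediateField.adjoin k {(RatFunc.X : RatFunc k) ^ p}

variable {k}

namespace DiffOp

theorem ofField_injective {K : Type*} [Field K] [Differential K] :
    Function.Injective (ofField : K →+* DiffOp K) := fun _ _ h => C_injective h

/-- In characteristic `p`, the operator `∂ᵖ` commutes with `k(t)`. -/
theorem del_pow_char_mul_ofField [Fact p.Prime] [CharP k p] (f : RatFunc k) :
    (del : DiffOp (RatFunc k)) ^ p * ofField f = ofField f * del ^ p := by
  let A := DiffOp (RatFunc k)
  have : CharP (RatFunc k) p := charP_of_injective_algebraMap (algebraMap k (RatFunc k)).injective p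
  have : CharP A p := charP_of_injective_ringHom (ofField_injective (K := RatFunc k)) p
  have : CharP (AddMonoid.End A) p := by
    refine charP_of_injective_ringHom (f := Module.toAddMonoidEnd A A) (fun a b h => ?_) p
    have h1 : a * 1 = b * 1 := DFunLike.congr_fun h (1 : A)
    rwa [mul_one, mul_one] at h1
  let l : AddMonoid.End A := AddMonoidHom.mulLeft del
  let r : AddMonoid.End A := AddMonoidHom.mulRight del
  have hc : Commute l r := by
    ext x
    exact (mul_assoc del x del).symm
  have hmul : ∀ (u v : AddMonoid.End A) (x : A), (u * v) x = u (v x) := fun _ _ _ => rfl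
  have hl : ∀ (n : ℕ) (x : A), (l ^ n) x = del ^ n * x := by
    intro n
    induction n with
    | zero => intro x; simp
    | succ n ih =>
      intro x
      rw [pow_succ, hmul, ih, pow_succ, mul_assoc]; rfl
  have hr : ∀ (n : ℕ) (x : A), (r ^ n) x = x * del ^ n := by
    intro n
    induction n with
    | zero => intro x; simp
    | succ n ih =>
      intro x
      rw [pow_succ, hmul, ih, pow_succ', ← mul_assoc]; rfl
  have hlr : ∀ (n : ℕ) (f : RatFunc k),
      ((l - r) ^ n) (ofField f) = ofField (RatFunc.ddt^[n] f) := by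
    intro n
    induction n with
    | zero => intro f; rfl
    | succ n ih =>
      intro f
      have h1 : (l - r) (ofField f) = ofField f′ := by
        change del * ofField f - ofField f * del = _
        rw [del_mul_ofField, add_sub_cancel_left]
      rw [pow_succ, hmul, h1, ih, Function.iterate_succ_apply, RatFunc.deriv_eq_ddt]
  have h := hlr p f
  rw [RatFunc.iterate_ddt_char p f, map_zero, sub_pow_char_of_commute p hc] at h
  have h' : (l ^ p) (ofField f) - (r ^ p) (ofField f) = 0 := h
  rw [hl, hr] at h'
  exact sub_eq_zero.1 h'

/-- The `p`-curvature of `L`: the `k(t)`-linear endomorphism of `𝒟_L` given by the multiplication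
by `∂ᵖ` on the left. -/
def pCurvature [Fact p.Prime] [CharP k p] (L : DiffOp (RatFunc k)) :
    Module.End (RatFunc k) (Quot L) where
  toFun x := (del : DiffOp (RatFunc k)) ^ p • x
  map_add' x y := smul_add _ x y
  map_smul' f x := by
    obtain ⟨M, rfl⟩ := Submodule.Quotient.mk_surjective _ x
    rw [RingHom.id_apply, ← Submodule.Quotient.mk_smul, ← Submodule.Quotient.mk_smul,
      ← Submodule.Quotient.mk_smul, ← Submodule.Quotient.mk_smul]
    congr 1
    rw [smul_eq_mul, smul_eq_mul, ← ofField_mul, ← ofField_mul, ← mul_assoc, ← mul_assoc,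
      del_pow_char_mul_ofField]

/-- The characteristic polynomial `χ(ψ_p^L)` of the `p`-curvature of `L ≠ 0`. -/
def pCurvatureCharpoly [Fact p.Prime] [CharP k p] (L : DiffOp (RatFunc k)) (hL : L ≠ 0) :
    (RatFunc k)[X] :=
  haveI := finite_quot L hL
  (pCurvature p L).charpoly

/-- The separability hypothesis on `L ≠ 0`: all irreducible factors over `k(tᵖ)` of the
characteristic polynomial of the `p`-curvature of `L` are separable. -/
def SeparabilityHypothesis [Fact p.Prime] [CharP k p] (L : DiffOp (RatFunc k)) (hL : L ≠ 0) :
    Prop :=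
  ∀ N : (FrobField k p)[X], Irreducible N →
    N.map (algebraMap (FrobField k p) (RatFunc k)) ∣ pCurvatureCharpoly p L hL → N.Separable

/-- The central operator `N(∂ᵖ)`, for `N ∈ k(tᵖ)[Y]`. -/
def centralOp (N : (FrobField k p)[X]) : DiffOp (RatFunc k) :=
  N.eval₂ ((ofField (K := RatFunc k)).comp (algebraMap (FrobField k p) (RatFunc k))) (del ^ p)

end DiffOp

end CharP

end

/-! Write `K = k(t)`, `C = k(tᵖ)`, and let `K[Y]` act through `Y ↦ ∂ᵖ`. For `N ∈ C[Y]` the operator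
`N(∂ᵖ)` is central, and its left ideal corresponds to the ordinary polynomial ideal generated by
`N(Xᵖ)`; hence `𝒟_{N(∂ᵖ)}` has dimension `p · deg N` over `K` (`finrank_quot_centralOp`). The rest
is mostly comparison with this number.

Coefficients: commuting with `∂` shows that the annihilator of `ψ` in `K[Y]` is stable under
differentiation of coefficients, so the minimal polynomial has constant coefficients. Separability
keeps its irreducible factors irreducible over the purely inseparable extension `K/C`, so its monic
divisors `P_i` descend to `C`.

Number and valuation: `𝒟_L / P_1` is `(K[Y]/P_1)^m`, a quotient of `𝒟_{P_1(∂ᵖ)}`, whence `m ≤ p`. If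
`N(∂ᵖ)` divides `L`, then `𝒟_{N(∂ᵖ)}` is a quotient of `𝒟_L`, so `p · deg N ≤ ∑ deg gcd(P_i, N) ≤ m
· deg N`; equality gives `m = p` and `N ∣ P_i` for all `i` (`card_eq_and_dvd`). Conversely, if `m =
p` and `N` divides every `P_i`, equality of dimensions puts `L` in `K⟨∂⟩N(∂ᵖ)` (`isRightDivisor`).
Applied to powers of `N`, these give `ν_N(P_1) = ν`.

LCLM: if `P_p = N^ν R` with `N ∤ R`, then `N^ν(∂ᵖ)R(∂ᵖ)` lies in `K⟨∂⟩L`, and a Bézout relation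
between `N^ν` and `R` concludes (`isLCLM_of_isCoprime`). -/

noncomputable section

/-! ### The field of constants `k(tᵖ)` of `k(t)` -/

namespace RatFunc

variable {k : Type*} [Field k] (p : ℕ)

theorem algebraMap_expand_mem_frobField (g : k[X]) :
    algebraMap k[X] (RatFunc k) (expand k p g) ∈ FrobField k p := by
  have h : algebraMap k[X] (RatFunc k) (expand k p g) = aeval ((RatFunc.X : RatFunc k) ^ p) g := by
    rw [expand_eq_comp_X_pow, ← RatFunc.algebraMap_X, ← map_pow, aeval_algebraMap_apply,
      Polynomial.aeval_def, algebraMap_eq, Polynomial.comp]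
  rw [h, Polynomial.aeval_def, eval₂_eq_sum, Polynomial.sum_def]
  exact sum_mem fun i _ => mul_mem ((FrobField k p).algebraMap_mem _)
    (pow_mem (IntermediateField.mem_adjoin_simple_self k _) i)

/-- For a polynomial, `g(t)ᵖ = g^σ(tᵖ)`, where `g^σ` has the coefficients of `g` raised to the power
`p`. -/
theorem pow_mem_frobField [Fact p.Prime] [CharP k p] (f : RatFunc k) :
    f ^ p ∈ FrobField k p := by
  have key : ∀ g : k[X], algebraMap k[X] (RatFunc k) g ^ p ∈ FrobField k p := by
    intro g
    rw [← map_pow, ← Polynomial.map_frobenius_expand, Polynomial.map_expand]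
    exact algebraMap_expand_mem_frobField p _
  obtain ⟨a, b, -, rfl⟩ := exists_div f
  rw [div_pow]
  exact div_mem (key a) (key b)

instance isPurelyInseparable_frobField [Fact p.Prime] [CharP k p] :
    IsPurelyInseparable (FrobField k p) (RatFunc k) := by
  have : CharP (FrobField k p) p :=
    charP_of_injective_algebraMap (algebraMap k (FrobField k p)).injective p
  have : ExpChar (FrobField k p) p := ExpChar.prime Fact.out
  rw [isPurelyInseparable_iff_pow_mem (FrobField k p) p]
  exact fun x => ⟨1, ⟨x ^ p ^ 1, by rw [pow_one]; exact pow_mem_frobField p x⟩, rfl⟩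

/-- Write `a/b = ab^(p-1)/bᵖ`. Since `bᵖ` is constant, the polynomial `ab^(p-1)` has zero
derivative, hence is a polynomial in `tᵖ`. -/
theorem mem_frobField_of_ddt_eq_zero [Fact p.Prime] [CharP k p] {f : RatFunc k}
    (hf : ddt f = 0) : f ∈ FrobField k p := by
  obtain ⟨a, b, hb, rfl⟩ := exists_div f
  have hp : p ≠ 0 := (Fact.out : p.Prime).ne_zero
  have hb' := algebraMap_ne_zero' hb
  have h1 : derivative (a * b ^ (p - 1)) = 0 := by
    have h2 : ddt (algebraMap k[X] (RatFunc k) (a * b ^ (p - 1))) = 0 := by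
      have h3 : algebraMap k[X] (RatFunc k) (a * b ^ (p - 1))
          = algebraMap k[X] (RatFunc k) a / algebraMap k[X] (RatFunc k) b
            * algebraMap k[X] (RatFunc k) (b ^ p) := by
        obtain ⟨r, rfl⟩ := Nat.exists_eq_succ_of_ne_zero hp
        simp only [Nat.succ_eq_add_one, Nat.add_sub_cancel, pow_succ, map_mul]
        field_simp
      rw [h3, ddt_mul, hf, ddt_algebraMap, derivative_pow]
      simp [CharP.cast_eq_zero]
    rw [ddt_algebraMap] at h2
    exact (map_eq_zero_iff _ (algebraMap_injective k)).1 h2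
  have h4 : algebraMap k[X] (RatFunc k) a / algebraMap k[X] (RatFunc k) b
      = algebraMap k[X] (RatFunc k) (expand k p (contract p (a * b ^ (p - 1))))
        / algebraMap k[X] (RatFunc k) b ^ p := by
    rw [expand_contract p h1 hp, map_mul, map_pow]
    obtain ⟨r, rfl⟩ := Nat.exists_eq_succ_of_ne_zero hp
    simp only [Nat.succ_eq_add_one, Nat.add_sub_cancel, pow_succ]
    field_simp
  rw [h4]
  exact div_mem (algebraMap_expand_mem_frobField p _) (pow_mem_frobField p _)

theorem ddt_eq_zero_of_mem_frobField [CharP k p] {f : RatFunc k} (hf : f ∈ FrobField k p) :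
    ddt f = 0 := by
  have hinv : ∀ x : RatFunc k, ddt x = 0 → ddt x⁻¹ = 0 := by
    intro x hx
    by_cases h0 : x = 0
    · rw [h0] at hx ⊢
      rwa [inv_zero]
    · have h : ddt (x * x⁻¹) = 0 := by
        rw [mul_inv_cancel₀ h0]
        simpa using ddt_algebraMap (k := k) 1
      rw [ddt_mul, hx, mul_zero, add_zero] at h
      exact (mul_eq_zero.1 h).resolve_left h0
  induction hf using IntermediateField.adjoin_induction with
  | mem x hx =>
    rw [Set.mem_singleton_iff.1 hx, ← RatFunc.algebraMap_X, ← map_pow, ddt_algebraMap,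
      derivative_X_pow]
    simp [CharP.cast_eq_zero]
  | algebraMap x =>
    have := ddt_algebraMap (Polynomial.C x)
    rwa [derivative_C, map_zero, RatFunc.algebraMap_C] at this
  | add x y _ _ hx hy => rw [ddt_add, hx, hy, add_zero]
  | inv x _ hx => exact hinv x hx
  | mul x y _ _ hx hy => rw [ddt_mul, hx, hy, mul_zero, mul_zero, add_zero]

end RatFunc

/-! ### Divisors of polynomials over a subfield -/

/-- If the irreducible factors of `Q ∈ F[X]` remain irreducible over `E`, then every divisor of `Q`
over `E` is, up to a unit, defined over `F`. -/
theorem Polynomial.exists_associated_map_of_dvd_map {F E : Type*} [Field F] [Field E] [Algebra F E]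
    (Q : F[X]) (hQ : Q ≠ 0)
    (hirr : ∀ N : F[X], Irreducible N → N ∣ Q → Irreducible (N.map (algebraMap F E)))
    (P : E[X]) (hP : P ∣ Q.map (algebraMap F E)) :
    ∃ R : F[X], Associated P (R.map (algebraMap F E)) := by
  induction Q using WfDvdMonoid.induction_on_irreducible generalizing P with
  | zero => exact absurd rfl hQ
  | unit u hu =>
    have h : IsUnit P := isUnit_of_dvd_unit hP (hu.map (mapRingHom (algebraMap F E)))
    exact ⟨1, by rw [Polynomial.map_one]; exact associated_one_iff_isUnit.2 h⟩
  | mul a i ha hi ih =>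
    have ih' := ih ha fun N hN hd => hirr N hN (hd.mul_left i)
    have hi' := hirr i hi (dvd_mul_right i a)
    rw [Polynomial.map_mul] at hP
    -- Either the prime `i` cancels from both sides, or `P` is coprime to it and already divides
    -- `a`.
    by_cases hd : i.map (algebraMap F E) ∣ P
    · obtain ⟨P', rfl⟩ := hd
      obtain ⟨R, hR⟩ := ih' P' ((mul_dvd_mul_iff_left hi'.ne_zero).1 hP)
      exact ⟨i * R, by rw [Polynomial.map_mul]; exact hR.mul_left _⟩
    · exact ih' P (((hi'.coprime_iff_not_dvd).2 hd).symm.dvd_of_dvd_mul_left hP)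

theorem Polynomial.exists_map_eq_of_monic_of_dvd_map {F E : Type*} [Field F] [Field E]
    [Algebra F E] (Q : F[X]) (hQ : Q ≠ 0)
    (hirr : ∀ N : F[X], Irreducible N → N ∣ Q → Irreducible (N.map (algebraMap F E)))
    (P : E[X]) (hmon : P.Monic) (hP : P ∣ Q.map (algebraMap F E)) :
    ∃ R : F[X], R.map (algebraMap F E) = P := by
  obtain ⟨R, hR⟩ := exists_associated_map_of_dvd_map Q hQ hirr P hP
  have hR0 : R ≠ 0 := by
    rintro rfl
    rw [Polynomial.map_zero, associated_zero_iff_eq_zero] at hR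
    exact hmon.ne_zero hR
  refine ⟨R * C R.leadingCoeff⁻¹, ?_⟩
  have hmon' := (monic_mul_leadingCoeff_inv hR0).map (algebraMap F E)
  refine (eq_of_monic_of_associated hmon hmon' (hR.trans ?_)).symm
  rw [Polynomial.map_mul]
  refine (associated_mul_unit_right _ _ ?_)
  rw [Polynomial.map_C]
  exact isUnit_C.2 (by simpa using hR0)

/-! ### The action of `k(t)[Y]` on differential operators through `Y ↦ ∂ᵖ` -/

namespace DiffOp

variable {k : Type*} [Field k] (p : ℕ)

/-- With coefficients on the left, right multiplication by `∂` never differentiates them, unlike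
left multiplication. -/
theorem toPoly_mul_del {K : Type*} [Field K] [Differential K] (M : DiffOp K) :
    toPoly (M * del) = toPoly M * X := by
  rw [toPoly_mul, toPoly_del, mulAux]
  have h : ∀ i, dMul^[i] (X : K[X]) = X ^ (i + 1) := fun i => by
    have h1 : (dMul 1 : K[X]) = X := by simpa using iterate_dMul_one (K := K) 1
    rw [← iterate_dMul_one, Function.iterate_succ_apply, h1]
  simp only [h, pow_succ, ← mul_assoc, C_mul_X_pow_eq_monomial]
  rw [Polynomial.sum_def, ← Finset.sum_mul, ← Polynomial.sum_def, sum_monomial_eq]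

theorem toPoly_mul_del_pow {K : Type*} [Field K] [Differential K] (M : DiffOp K) (n : ℕ) :
    toPoly (M * del ^ n) = toPoly M * X ^ n := by
  induction n with
  | zero => simp
  | succ n ih => rw [pow_succ, ← mul_assoc, toPoly_mul_del, ih, pow_succ, mul_assoc]

/-- Induction on operators: from `K`, through sums and right multiplication by `∂`. -/
theorem induction_mul_del {K : Type*} [Field K] [Differential K] {q : DiffOp K → Prop}
    (hadd : ∀ L M, q L → q M → q (L + M)) (hC : ∀ f, q (ofField f))
    (hdel : ∀ L, q L → q (L * del)) (L : DiffOp K) : q L := by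
  have h : ∀ P : K[X], q (toPoly.symm P) := by
    intro P
    induction P using Polynomial.induction_on' with
    | add P Q hP hQ => rw [map_add]; exact hadd _ _ hP hQ
    | monomial n a =>
      have h1 : toPoly.symm (monomial n a) = ofField a * del ^ n := by
        apply toPoly.injective
        rw [toPoly_mul_del_pow, toPoly_ofField, LinearEquiv.apply_symm_apply,
          C_mul_X_pow_eq_monomial]
      rw [h1]
      clear h1
      induction n with
      | zero => simpa using hC a
      | succ n ih => rw [pow_succ, ← mul_assoc]; exact hdel _ ih
  exact h (toPoly L)

variable [Fact p.Prime] [CharP k p]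

theorem del_pow_char_mul (M : DiffOp (RatFunc k)) :
    (del : DiffOp (RatFunc k)) ^ p * M = M * del ^ p := by
  induction M using induction_mul_del with
  | hadd L M hL hM => rw [mul_add, add_mul, hL, hM]
  | hC f => exact del_pow_char_mul_ofField p f
  | hdel L hL => rw [← mul_assoc, hL, mul_assoc, mul_assoc, ← pow_succ, ← pow_succ']

/-- The ring homomorphism `k(t)[Y] → k(t)⟨∂⟩` sending `Y` to `∂ᵖ`. -/
def evalDelPow : (RatFunc k)[X] →+* DiffOp (RatFunc k) :=
  eval₂RingHom' ofField (del ^ p) fun f => (del_pow_char_mul p (ofField f)).symm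

theorem evalDelPow_C (f : RatFunc k) : evalDelPow p (C f) = ofField f := eval₂_C _ _

theorem evalDelPow_X : evalDelPow p (X : (RatFunc k)[X]) = del ^ p := eval₂_X _ _

theorem centralOp_eq (N : (FrobField k p)[X]) :
    centralOp p N = evalDelPow p (N.map (algebraMap (FrobField k p) (RatFunc k))) := by
  change _ = eval₂ _ _ _
  rw [eval₂_map, centralOp]

theorem centralOp_pow (N : (FrobField k p)[X]) (n : ℕ) :
    centralOp p N ^ n = centralOp p (N ^ n) := by
  rw [centralOp_eq, centralOp_eq, Polynomial.map_pow, map_pow]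

/-- Powers of `∂ᵖ` move to the right of `M`, where they only shift degrees, while the coefficients
of `f` stay on the left. The noncommutative product thus becomes a commutative one. -/
theorem toPoly_evalDelPow_mul (f : (RatFunc k)[X]) (M : DiffOp (RatFunc k)) :
    toPoly (evalDelPow p f * M) = expand (RatFunc k) p f * toPoly M := by
  induction f using Polynomial.induction_on' with
  | add f g hf hg => rw [map_add, add_mul, map_add, hf, hg, map_add, add_mul]
  | monomial n a =>
    have h : (del ^ p) ^ n * M = M * (del ^ p) ^ n :=
      (show Commute (del ^ p) M from del_pow_char_mul p M).pow_left n
    rw [← C_mul_X_pow_eq_monomial, map_mul (evalDelPow p), map_pow (evalDelPow p), evalDelPow_C,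
      evalDelPow_X, mul_assoc, h,
      ofField_mul, map_smul, ← pow_mul, toPoly_mul_del_pow, map_mul (expand (RatFunc k) p), map_pow,
      expand_C, expand_X, smul_eq_C_mul, pow_mul]
    ring

theorem toPoly_evalDelPow (f : (RatFunc k)[X]) :
    toPoly (evalDelPow p f) = expand (RatFunc k) p f := by
  have := toPoly_evalDelPow_mul p f 1
  rwa [mul_one, show toPoly (1 : DiffOp (RatFunc k)) = 1 from rfl, mul_one] at this

theorem del_mul_evalDelPow (f : (RatFunc k)[X]) :
    del * evalDelPow p f = evalDelPow p f * del + evalDelPow p (Differential.mapCoeffs f) := by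
  induction f using Polynomial.induction_on' with
  | add f g hf hg => rw [map_add, mul_add, hf, hg, add_mul, map_add, map_add]; abel
  | monomial n a =>
    rw [Differential.mapCoeffs_monomial, ← C_mul_X_pow_eq_monomial, ← C_mul_X_pow_eq_monomial,
      map_mul, map_mul, map_pow, evalDelPow_C, evalDelPow_C, evalDelPow_X, ← mul_assoc,
      del_mul_ofField, add_mul, mul_assoc, mul_assoc, ← pow_mul, ← pow_succ, ← pow_succ']

/-- By `del_mul_evalDelPow` the commutator with `∂` is obtained by differentiating the coefficients
of `N`, which are constants. -/
theorem centralOp_mul_comm (N : (FrobField k p)[X]) (M : DiffOp (RatFunc k)) :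
    centralOp p N * M = M * centralOp p N := by
  rw [centralOp_eq]
  set f := N.map (algebraMap (FrobField k p) (RatFunc k)) with hf
  have hd : Differential.mapCoeffs f = 0 := by
    ext i
    rw [Differential.coeff_mapCoeffs, hf, coeff_map, RatFunc.deriv_eq_ddt, coeff_zero]
    exact RatFunc.ddt_eq_zero_of_mem_frobField p (N.coeff i).2
  induction M using induction_mul_del with
  | hadd L M hL hM => rw [mul_add, add_mul, hL, hM]
  | hC a => rw [← evalDelPow_C p, ← map_mul, mul_comm, map_mul]
  | hdel L hL =>
    rw [← mul_assoc, hL, mul_assoc, mul_assoc, del_mul_evalDelPow, hd, map_zero, add_zero]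

theorem mem_span_centralOp (N : (FrobField k p)[X]) (M : DiffOp (RatFunc k)) :
    M ∈ Submodule.span (DiffOp (RatFunc k)) {centralOp p N} ↔
      expand (RatFunc k) p (N.map (algebraMap (FrobField k p) (RatFunc k))) ∣ toPoly M := by
  rw [Submodule.mem_span_singleton]
  constructor
  · rintro ⟨a, rfl⟩
    rw [smul_eq_mul, ← centralOp_mul_comm, centralOp_eq, toPoly_evalDelPow_mul]
    exact dvd_mul_right _ _
  · rintro ⟨a, ha⟩
    refine ⟨toPoly.symm a, toPoly.injective ?_⟩
    rw [smul_eq_mul, ← centralOp_mul_comm, centralOp_eq, toPoly_evalDelPow_mul, ha,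
      LinearEquiv.apply_symm_apply]

theorem finrank_quot_centralOp (N : (FrobField k p)[X]) (hN : N ≠ 0) :
    Module.finrank (RatFunc k) (Quot (centralOp p N)) = p * N.natDegree := by
  set g := expand (RatFunc k) p (N.map (algebraMap (FrobField k p) (RatFunc k))) with hg
  have hg0 : g ≠ 0 := by
    rw [hg, Ne, expand_eq_zero (Fact.out : p.Prime).pos, Polynomial.map_eq_zero]
    exact hN
  let S : Submodule (RatFunc k) (DiffOp (RatFunc k)) :=
    (Submodule.span (DiffOp (RatFunc k)) {centralOp p N}).restrictScalars (RatFunc k)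
  let T : Submodule (RatFunc k) (RatFunc k)[X] :=
    (Ideal.span {g}).restrictScalars (RatFunc k)
  have hST : S.map (toPoly (K := RatFunc k)).toLinearMap = T := by
    ext x
    constructor
    · rintro ⟨y, hy, rfl⟩
      exact Ideal.mem_span_singleton.2 ((mem_span_centralOp p N y).1 hy)
    · intro hx
      refine ⟨toPoly.symm x, (mem_span_centralOp p N _).2 ?_, LinearEquiv.apply_symm_apply _ _⟩
      rw [LinearEquiv.apply_symm_apply]
      exact Ideal.mem_span_singleton.1 hx
  have h1 : Module.finrank (RatFunc k) (DiffOp (RatFunc k) ⧸ S)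
      = Module.finrank (RatFunc k) ((RatFunc k)[X] ⧸ T) :=
    (Submodule.Quotient.equiv S T toPoly hST).finrank_eq
  have h2 : Module.finrank (RatFunc k) ((RatFunc k)[X] ⧸ T) = g.natDegree :=
    finrank_quotient_span_eq_natDegree
  have h3 : g.natDegree = p * N.natDegree := by
    rw [hg, natDegree_expand, natDegree_map, mul_comm]
  exact (h1.trans h2).trans h3

end DiffOp

/-! ### Invariant factors of the `p`-curvature -/

namespace DiffOp

variable {k : Type*} [Field k] (p : ℕ) [Fact p.Prime] [CharP k p]

theorem centralOp_ne_zero {N : (FrobField k p)[X]} (hN : N ≠ 0) : centralOp p N ≠ 0 := by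
  intro h
  have h1 := toPoly_evalDelPow p (N.map (algebraMap (FrobField k p) (RatFunc k)))
  rw [← centralOp_eq, h, map_zero, eq_comm, expand_eq_zero (Fact.out : p.Prime).pos,
    Polynomial.map_eq_zero] at h1
  exact hN h1

theorem aeval_pCurvature_mk (L : DiffOp (RatFunc k)) (f : (RatFunc k)[X])
    (M : DiffOp (RatFunc k)) :
    aeval (pCurvature p L) f (Submodule.Quotient.mk M)
      = (Submodule.Quotient.mk (evalDelPow p f * M) : Quot L) := by
  induction f using Polynomial.induction_on' with
  | add f g hf hg =>
    rw [map_add, LinearMap.add_apply, hf, hg, map_add, add_mul, Submodule.Quotient.mk_add]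
  | monomial n a =>
    have h : ∀ x : DiffOp (RatFunc k), (pCurvature p L ^ n) (Submodule.Quotient.mk x)
        = (Submodule.Quotient.mk ((del ^ p) ^ n * x) : Quot L) := by
      induction n with
      | zero => intro x; simp
      | succ n ih =>
        intro x
        rw [pow_succ', Module.End.mul_apply, ih, pow_succ', mul_assoc]
        rfl
    rw [aeval_monomial, Module.End.mul_apply, h, ← C_mul_X_pow_eq_monomial, map_mul, map_pow,
      evalDelPow_C, evalDelPow_X, mul_assoc, ofField_mul, Module.algebraMap_end_apply,
      Submodule.Quotient.mk_smul]

/-- The quantifier over `M` matters: `f(∂ᵖ)` need not be central when the coefficients of `f` are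
not constant. -/
theorem aeval_pCurvature_eq_zero_iff (L : DiffOp (RatFunc k)) (f : (RatFunc k)[X]) :
    aeval (pCurvature p L) f = 0 ↔
      ∀ M, evalDelPow p f * M ∈ Submodule.span (DiffOp (RatFunc k)) {L} := by
  constructor
  · intro h M
    have hM := aeval_pCurvature_mk p L f M
    rw [h, LinearMap.zero_apply] at hM
    exact (Submodule.Quotient.mk_eq_zero _).1 hM.symm
  · intro h
    refine LinearMap.ext fun x => ?_
    obtain ⟨M, rfl⟩ := Submodule.Quotient.mk_surjective _ x
    exact (aeval_pCurvature_mk p L f M).trans ((Submodule.Quotient.mk_eq_zero _).2 (h M))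

/-- The polynomials annihilating the `p`-curvature are stable under the derivation. -/
theorem aeval_pCurvature_mapCoeffs (L : DiffOp (RatFunc k)) (f : (RatFunc k)[X])
    (hf : aeval (pCurvature p L) f = 0) :
    aeval (pCurvature p L) (Differential.mapCoeffs f) = 0 := by
  rw [aeval_pCurvature_eq_zero_iff] at hf ⊢
  intro M
  have h : evalDelPow p (Differential.mapCoeffs f) * M
      = (del : DiffOp (RatFunc k)) • (evalDelPow p f * M) - evalDelPow p f * (del * M) := by
    rw [smul_eq_mul, ← mul_assoc, del_mul_evalDelPow, add_mul, mul_assoc, add_sub_cancel_left]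
  rw [h]
  exact sub_mem (Submodule.smul_mem _ _ (hf M)) (hf _)

theorem exists_map_eq_minpoly_pCurvature (L : DiffOp (RatFunc k)) (hL : L ≠ 0) :
    ∃ Q : (FrobField k p)[X],
      Q.map (algebraMap (FrobField k p) (RatFunc k)) = minpoly (RatFunc k) (pCurvature p L) := by
  have := finite_quot L hL
  set μ := minpoly (RatFunc k) (pCurvature p L) with hμ
  have hint : IsIntegral (RatFunc k) (pCurvature p L) := Algebra.IsIntegral.isIntegral _
  have hmon : μ.Monic := minpoly.monic hint
  have hdvd : μ ∣ Differential.mapCoeffs μ :=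
    minpoly.dvd _ _ (aeval_pCurvature_mapCoeffs p L μ (minpoly.aeval _ _))
  -- The leading coefficient `1` has derivative zero, so the derivative of `μ` has smaller degree
  -- than `μ`, which divides it.
  have hd : Differential.mapCoeffs μ = 0 := by
    refine eq_zero_of_dvd_of_degree_lt hdvd ?_
    rw [degree_eq_natDegree hmon.ne_zero, degree_lt_iff_coeff_zero]
    intro i hi
    rw [Differential.coeff_mapCoeffs]
    rcases hi.eq_or_lt with rfl | hi
    · rw [hmon.coeff_natDegree, RatFunc.deriv_eq_ddt]
      exact RatFunc.ddt_eq_zero_of_mem_frobField p (one_mem _)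
    · rw [coeff_eq_zero_of_natDegree_lt hi, map_zero]
  have hl : μ ∈ lifts (algebraMap (FrobField k p) (RatFunc k)) := by
    rw [lifts_iff_coeff_lifts]
    intro n
    have h : RatFunc.ddt (μ.coeff n) = 0 := by
      rw [← RatFunc.deriv_eq_ddt, ← Differential.coeff_mapCoeffs, hd, coeff_zero]
    exact ⟨⟨_, RatFunc.mem_frobField_of_ddt_eq_zero p h⟩, rfl⟩
  exact (mem_lifts _).1 hl

/-! ### Decomposition of `𝒟_L` into cyclic modules -/

variable {p}
variable {L : DiffOp (RatFunc k)} {m : ℕ} {P : Fin m → (RatFunc k)[X]}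

/-- Lifts the decomposition of `𝒟_L` to operators, so that later arguments only test membership in
`K⟨∂⟩L`. -/
theorem exists_presentation (hP : IsFrobeniusInvariants (pCurvature p L) P) :
    ∃ π : DiffOp (RatFunc k) →ₗ[RatFunc k] (∀ i, (RatFunc k)[X] ⧸ Ideal.span {P i}),
      Function.Surjective π ∧ (∀ f x, π (evalDelPow p f * x) = f • π x) ∧
      ∀ x, π x = 0 ↔ x ∈ Submodule.span (DiffOp (RatFunc k)) {L} := by
  obtain ⟨e⟩ := hP.equiv
  let q : DiffOp (RatFunc k) →ₗ[RatFunc k] Quot L :=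
    (Submodule.mkQ (Submodule.span (DiffOp (RatFunc k)) {L})).restrictScalars (RatFunc k)
  let u := Module.AEval'.of (pCurvature p L)
  refine ⟨(e.toLinearMap.restrictScalars (RatFunc k)).comp (u.toLinearMap.comp q), ?_, ?_, ?_⟩
  · exact e.surjective.comp (u.surjective.comp (Submodule.mkQ_surjective _))
  · intro f x
    change e (u (Submodule.Quotient.mk (evalDelPow p f * x))) = f • e (u (Submodule.Quotient.mk x))
    rw [← aeval_pCurvature_mk, ← map_smul]
    rfl
  · intro x
    change e (u (Submodule.Quotient.mk x)) = 0 ↔ _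
    rw [LinearEquiv.map_eq_zero_iff, LinearEquiv.map_eq_zero_iff, Submodule.Quotient.mk_eq_zero]

theorem IsFrobeniusInvariants.dvd_of_forall_mem
    (hP : IsFrobeniusInvariants (pCurvature p L) P) {f : (RatFunc k)[X]}
    (hf : ∀ M, evalDelPow p f * M ∈ Submodule.span (DiffOp (RatFunc k)) {L}) (i : Fin m) :
    P i ∣ f := by
  obtain ⟨π, hsurj, hπ, hker⟩ := exists_presentation hP
  obtain ⟨x, hx⟩ := hsurj fun _ => 1
  have h := (hker _).2 (hf x)
  rw [hπ, hx] at h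
  have hi : f • (1 : (RatFunc k)[X] ⧸ Ideal.span {P i}) = 0 := congrFun h i
  have hf1 : f • (1 : (RatFunc k)[X] ⧸ Ideal.span {P i}) = Ideal.Quotient.mk _ (f * 1) := rfl
  rwa [hf1, mul_one, Ideal.Quotient.eq_zero_iff_mem, Ideal.mem_span_singleton] at hi

theorem IsFrobeniusInvariants.mem_of_forall_dvd
    (hP : IsFrobeniusInvariants (pCurvature p L) P) {f : (RatFunc k)[X]}
    (hf : ∀ i, P i ∣ f) (M : DiffOp (RatFunc k)) :
    evalDelPow p f * M ∈ Submodule.span (DiffOp (RatFunc k)) {L} := by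
  obtain ⟨π, -, hπ, hker⟩ := exists_presentation hP
  rw [← hker, hπ]
  funext i
  obtain ⟨a, ha⟩ := Ideal.Quotient.mk_surjective (π M i)
  have hfa : f • Ideal.Quotient.mk (Ideal.span {P i}) a = Ideal.Quotient.mk _ (f * a) := rfl
  rw [Pi.smul_apply, ← ha, hfa, Pi.zero_apply, Ideal.Quotient.eq_zero_iff_mem, Ideal.mem_span_singleton]
  exact (hf i).mul_right a

/-- The Frobenius invariants are defined over `k(tᵖ)`. -/
theorem IsFrobeniusInvariants.exists_map_eq (hL : L ≠ 0) (hsep : SeparabilityHypothesis p L hL)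
    (hP : IsFrobeniusInvariants (pCurvature p L) P) (i : Fin m) :
    ∃ Q : (FrobField k p)[X], Q.map (algebraMap (FrobField k p) (RatFunc k)) = P i := by
  have := finite_quot L hL
  obtain ⟨Q, hQ⟩ := exists_map_eq_minpoly_pCurvature p L hL
  have hint : IsIntegral (RatFunc k) (pCurvature p L) := Algebra.IsIntegral.isIntegral _
  refine exists_map_eq_of_monic_of_dvd_map Q ?_ ?_ (P i) (hP.monic i) ?_
  · rintro rfl
    rw [Polynomial.map_zero] at hQ
    exact minpoly.ne_zero hint hQ.symm
  · intro N hN hd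
    -- The hypothesis concerns factors of the characteristic polynomial, which the minimal
    -- polynomial divides.
    refine Separable.map_irreducible_of_isPurelyInseparable _ (hsep N hN ?_) hN
    exact ((map_dvd_map' _).2 hd).trans (hQ ▸ LinearMap.minpoly_dvd_charpoly _)
  · rw [hQ]
    exact dvd_of_forall_mem hP ((aeval_pCurvature_eq_zero_iff p L _).1 (minpoly.aeval _ _)) i

/-- If `N` divides all `P i`, then `K⟨∂⟩ / K⟨∂⟩ N(∂ᵖ)` surjects onto `(K[Y]/N)ᵐ`, through a map
that kills the class of `L`. -/
theorem IsFrobeniusInvariants.exists_surjective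
    (hP : IsFrobeniusInvariants (pCurvature p L) P) (N : (FrobField k p)[X])
    (hN : ∀ i, N.map (algebraMap (FrobField k p) (RatFunc k)) ∣ P i) :
    ∃ ρ : Quot (centralOp p N) →ₗ[RatFunc k] (Fin m → (RatFunc k)[X] ⧸
        Ideal.span {N.map (algebraMap (FrobField k p) (RatFunc k))}),
      Function.Surjective ρ ∧ ρ (Submodule.Quotient.mk L) = 0 := by
  obtain ⟨π, hsurj, hπ, hker⟩ := exists_presentation hP
  set f := N.map (algebraMap (FrobField k p) (RatFunc k)) with hf
  let c : ∀ i, ((RatFunc k)[X] ⧸ Ideal.span {P i}) →ₐ[RatFunc k] (RatFunc k)[X] ⧸ Ideal.span {f} :=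
    fun i => Ideal.Quotient.factorₐ (RatFunc k) ((Ideal.span_singleton_le_span_singleton).2 (hN i))
  let σ : DiffOp (RatFunc k) →ₗ[RatFunc k] (Fin m → (RatFunc k)[X] ⧸ Ideal.span {f}) :=
    LinearMap.pi fun i => (c i).toLinearMap.comp ((LinearMap.proj i).comp π)
  have hσ : ∀ x i, σ x i = c i (π x i) := fun _ _ => rfl
  have hσs : Function.Surjective σ := by
    intro y
    choose a ha using fun i => Ideal.Quotient.mk_surjective (y i)
    obtain ⟨x, hx⟩ := hsurj fun i => Ideal.Quotient.mk _ (a i)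
    refine ⟨x, funext fun i => ?_⟩
    rw [hσ, hx, ← ha]
    rfl
  let S : Submodule (RatFunc k) (DiffOp (RatFunc k)) :=
    (Submodule.span (DiffOp (RatFunc k)) {centralOp p N}).restrictScalars (RatFunc k)
  -- By centrality `a N(∂ᵖ) = N(∂ᵖ) a`, whose image is `N` times that of `a`, hence zero modulo `N`.
  have hS : S ≤ LinearMap.ker σ := by
    intro x hx
    obtain ⟨a, rfl⟩ := Submodule.mem_span_singleton.1 hx
    rw [LinearMap.mem_ker, smul_eq_mul, ← centralOp_mul_comm, centralOp_eq, ← hf]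
    funext i
    obtain ⟨b, hb⟩ := Ideal.Quotient.mk_surjective (π a i)
    rw [hσ, hπ, Pi.smul_apply, ← hb]
    change Ideal.Quotient.mk _ (f * b) = 0
    rw [Ideal.Quotient.eq_zero_iff_mem, Ideal.mem_span_singleton]
    exact dvd_mul_right f b
  refine ⟨S.liftQ σ hS, ?_, ?_⟩
  · intro y
    obtain ⟨x, rfl⟩ := hσs y
    exact ⟨Submodule.Quotient.mk x, rfl⟩
  · change σ L = 0
    funext i
    rw [hσ, (hker L).2 (Submodule.mem_span_singleton_self L), Pi.zero_apply, map_zero, Pi.zero_apply]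

/-! ### Dimension counts -/

theorem finrank_pi_quotient {K : Type*} [Field K] (m : ℕ) (f : K[X]) (hf : f ≠ 0) :
    Module.finrank K (Fin m → K[X] ⧸ Ideal.span {f}) = m * f.natDegree := by
  have : Module.Finite K (K[X] ⧸ Ideal.span {f}) :=
    Module.Finite.of_basis (AdjoinRoot.powerBasis hf).basis
  rw [Module.finrank_pi_fintype, Finset.sum_const, Finset.card_univ, Fintype.card_fin, smul_eq_mul,
    finrank_quotient_span_eq_natDegree]

/-- The smallest invariant divides all the others, so `exists_surjective` applies to it and yields
`m · deg P_1 ≤ p · deg P_1`. -/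
theorem IsFrobeniusInvariants.card_le (hP : IsFrobeniusInvariants (pCurvature p L) P)
    {Q : Fin m → (FrobField k p)[X]}
    (hQ : ∀ i, (Q i).map (algebraMap (FrobField k p) (RatFunc k)) = P i) : m ≤ p := by
  rcases Nat.eq_zero_or_pos m with rfl | hm
  · exact Nat.zero_le p
  let i₀ : Fin m := ⟨0, hm⟩
  have hQ0 : Q i₀ ≠ 0 := fun h => (hP.monic i₀).ne_zero (by rw [← hQ, h, Polynomial.map_zero])
  have hpos : 0 < (Q i₀).natDegree := by
    rw [← natDegree_map (algebraMap (FrobField k p) (RatFunc k)), hQ]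
    exact hP.natDegree_pos i₀
  obtain ⟨ρ, hρ, -⟩ := exists_surjective hP (Q i₀) fun i => by
    rw [hQ]; exact hP.dvd i₀ i (Fin.mk_le_of_le_val (Nat.zero_le _))
  have := finite_quot _ (centralOp_ne_zero p hQ0)
  have h := LinearMap.finrank_le_finrank_of_surjective hρ
  rw [finrank_quot_centralOp p _ hQ0, finrank_pi_quotient _ _ (by simpa using hQ0),
    natDegree_map] at h
  exact Nat.le_of_mul_le_mul_right h hpos

/-- If there are `p` Frobenius invariants, all divisible by `N`, then `N(∂ᵖ)` divides `L`. -/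
theorem IsFrobeniusInvariants.isRightDivisor {P : Fin p → (RatFunc k)[X]}
    (hP : IsFrobeniusInvariants (pCurvature p L) P) (N : (FrobField k p)[X]) (hN0 : N ≠ 0)
    (hN : ∀ i, N.map (algebraMap (FrobField k p) (RatFunc k)) ∣ P i) :
    IsRightDivisor (centralOp p N) L := by
  obtain ⟨ρ, hρ, hρL⟩ := exists_surjective hP N hN
  have hf0 : N.map (algebraMap (FrobField k p) (RatFunc k)) ≠ 0 := by simpa using hN0
  have := finite_quot _ (centralOp_ne_zero p hN0)
  have : Module.Finite (RatFunc k) ((RatFunc k)[X] ⧸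
      Ideal.span {N.map (algebraMap (FrobField k p) (RatFunc k))}) :=
    Module.Finite.of_basis (AdjoinRoot.powerBasis hf0).basis
  have h : Module.finrank (RatFunc k) (Quot (centralOp p N)) = Module.finrank (RatFunc k)
      (Fin p → (RatFunc k)[X] ⧸ Ideal.span {N.map (algebraMap (FrobField k p) (RatFunc k))}) := by
    rw [finrank_quot_centralOp p _ hN0, finrank_pi_quotient _ _ hf0, natDegree_map]
  -- Both sides have dimension `p · deg N`, so the class of `L`, which `ρ` kills, is already zero.
  have hinj := (LinearMap.injective_iff_surjective_of_finrank_eq_finrank h).2 hρ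
  have hmem := hinj (hρL.trans (map_zero ρ).symm)
  rw [Submodule.Quotient.mk_eq_zero, Submodule.mem_span_singleton] at hmem
  obtain ⟨a, ha⟩ := hmem
  exact ⟨a, ha.symm⟩

open scoped Classical in
/-- `K⟨∂⟩ / K⟨∂⟩ N(∂ᵖ)` is generated over `K[Y]` by `m` elements, the `i`-th of which is killed
by `gcd (P i) N`, when `N(∂ᵖ)` divides `L`. -/
theorem IsFrobeniusInvariants.le_sum_natDegree_gcd
    (hP : IsFrobeniusInvariants (pCurvature p L) P) (N : (FrobField k p)[X]) (hN0 : N ≠ 0)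
    (hdiv : IsRightDivisor (centralOp p N) L) :
    p * N.natDegree ≤ ∑ i, (EuclideanDomain.gcd (P i)
      (N.map (algebraMap (FrobField k p) (RatFunc k)))).natDegree := by
  obtain ⟨π, hsurj, hπ, hker⟩ := exists_presentation hP
  set f := N.map (algebraMap (FrobField k p) (RatFunc k)) with hf
  set g : Fin m → (RatFunc k)[X] := fun i => EuclideanDomain.gcd (P i) f with hg
  have hg0 : ∀ i, g i ≠ 0 := fun i h =>
    (hP.monic i).ne_zero (EuclideanDomain.gcd_eq_zero_iff.1 h).1
  set S := Submodule.span (DiffOp (RatFunc k)) {centralOp p N} with hS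
  have hLS : Submodule.span (DiffOp (RatFunc k)) {L} ≤ S := by
    obtain ⟨a, ha⟩ := hdiv
    rw [Submodule.span_singleton_le_iff_mem, hS, Submodule.mem_span_singleton]
    exact ⟨a, ha.symm⟩
  choose x hx using fun i => hsurj (Pi.single i 1)
  have hev : ∀ (h : (RatFunc k)[X]) (y : DiffOp (RatFunc k)), y ∈ S → evalDelPow p h * y ∈ S :=
    fun h y hy => S.smul_mem _ hy
  have hsmul : ∀ (h : (RatFunc k)[X]) i,
      h • (1 : (RatFunc k)[X] ⧸ Ideal.span {P i}) = Ideal.Quotient.mk _ h := fun h i =>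
    congrArg (Ideal.Quotient.mk (Ideal.span {P i})) (mul_one h)
  have hPx : ∀ i, evalDelPow p (P i) * x i ∈ S := by
    intro i
    refine hLS ((hker _).1 ?_)
    rw [hπ, hx]
    funext j
    rcases eq_or_ne j i with rfl | hij
    · rw [Pi.smul_apply, Pi.single_eq_same, hsmul, Pi.zero_apply, Ideal.Quotient.eq_zero_iff_mem]
      exact Ideal.mem_span_singleton_self _
    · rw [Pi.smul_apply, Pi.single_eq_of_ne hij, smul_zero, Pi.zero_apply]
  have hfx : ∀ y, evalDelPow p f * y ∈ S := by
    intro y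
    rw [hf, ← centralOp_eq, centralOp_mul_comm]
    exact S.smul_mem _ (Submodule.mem_span_singleton_self _)
  -- Modulo `S` the generator `x i` is killed by both `P i` and `N`, hence by their gcd through
  -- Bézout.
  have hgx : ∀ i h, g i ∣ h → evalDelPow p h * x i ∈ S := by
    rintro i _ ⟨b, rfl⟩
    have : g i * b = EuclideanDomain.gcdA (P i) f * b * P i
        + EuclideanDomain.gcdB (P i) f * b * f := by
      rw [hg]
      simp only [EuclideanDomain.gcd_eq_gcd_ab (P i) f]
      ring
    rw [this, map_add, map_mul, map_mul _ _ f, add_mul, mul_assoc, mul_assoc]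
    exact add_mem (hev _ _ (hPx i)) (hev _ _ (hfx _))
  let q : DiffOp (RatFunc k) →ₗ[RatFunc k] Quot (centralOp p N) :=
    S.mkQ.restrictScalars (RatFunc k)
  have hq : ∀ y z, q y = q z ↔ y - z ∈ S := fun y z => Submodule.Quotient.eq S
  let ev : Fin m → (RatFunc k)[X] →ₗ[RatFunc k] DiffOp (RatFunc k) := fun i =>
    { toFun := fun h => evalDelPow p h * x i
      map_add' := fun a b => by rw [map_add, add_mul]
      map_smul' := fun a b => by
        rw [smul_eq_C_mul, map_mul, evalDelPow_C, mul_assoc, ofField_mul, RingHom.id_apply] }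
  let Φ : (∀ i, degreeLT (RatFunc k) (g i).natDegree) →ₗ[RatFunc k] Quot (centralOp p N) :=
    ∑ i, q.comp ((ev i).comp ((degreeLT (RatFunc k) _).subtype.comp (LinearMap.proj i)))
  have hΦ : ∀ r, Φ r = q (∑ i, evalDelPow p (r i : (RatFunc k)[X]) * x i) := by
    intro r
    rw [map_sum, LinearMap.sum_apply]
    rfl
  have hΦs : Function.Surjective Φ := by
    intro v
    obtain ⟨y, rfl⟩ := Submodule.mkQ_surjective S v
    choose a ha using fun i => Ideal.Quotient.mk_surjective (π y i)
    -- Coefficients matter only modulo `g i`; taking remainders bounds the dimension by `∑ deg (g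
    -- i)`.
    refine ⟨fun i => ⟨a i % g i, mem_degreeLT.2 ?_⟩, ?_⟩
    · rw [← degree_eq_natDegree (hg0 i)]
      exact EuclideanDomain.mod_lt _ (hg0 i)
    · rw [hΦ]
      change _ = q y
      have h1 : y - ∑ i, evalDelPow p (a i) * x i ∈ S := by
        refine hLS ((hker _).1 ?_)
        rw [map_sub, map_sum, sub_eq_zero]
        funext j
        rw [Finset.sum_apply, Finset.sum_eq_single j]
        · rw [hπ, hx, Pi.smul_apply, Pi.single_eq_same, ← ha, hsmul]
        · intro i _ hij
          rw [hπ, hx, Pi.smul_apply, Pi.single_eq_of_ne hij.symm, smul_zero]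
        · intro h
          exact absurd (Finset.mem_univ j) h
      have h2 : ∑ i, evalDelPow p (a i) * x i - ∑ i, evalDelPow p (a i % g i) * x i ∈ S := by
        rw [← Finset.sum_sub_distrib]
        refine sum_mem fun i _ => ?_
        rw [← sub_mul, ← map_sub]
        refine hgx i _ ⟨a i / g i, ?_⟩
        rw [sub_eq_iff_eq_add]
        exact (EuclideanDomain.div_add_mod (a i) (g i)).symm
      rw [eq_comm, hq]
      simpa using add_mem h1 h2
  have hfin : ∀ i, Module.Finite (RatFunc k) (degreeLT (RatFunc k) (g i).natDegree) := fun i =>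
    Module.Finite.equiv (degreeLTEquiv (RatFunc k) (g i).natDegree).symm
  have h := LinearMap.finrank_le_finrank_of_surjective hΦs
  rw [finrank_quot_centralOp p _ hN0, Module.finrank_pi_fintype] at h
  refine h.trans (le_of_eq (Finset.sum_congr rfl fun i _ => ?_))
  rw [(degreeLTEquiv (RatFunc k) (g i).natDegree).finrank_eq, Module.finrank_fin_fun]

open scoped Classical in
/-- If `N(∂ᵖ)` divides `L`, with `N` nonconstant, then there are `p` Frobenius invariants, all of
which are divisible by `N`. -/
theorem IsFrobeniusInvariants.card_eq_and_dvd
    (hP : IsFrobeniusInvariants (pCurvature p L) P) (hm : m ≤ p) (N : (FrobField k p)[X])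
    (hpos : 0 < N.natDegree) (hdiv : IsRightDivisor (centralOp p N) L) :
    m = p ∧ ∀ i, N.map (algebraMap (FrobField k p) (RatFunc k)) ∣ P i := by
  have hN0 : N ≠ 0 := fun h => by rw [h, natDegree_zero] at hpos; exact hpos.false
  set f := N.map (algebraMap (FrobField k p) (RatFunc k)) with hf
  have hf0 : f ≠ 0 := by simpa [hf] using hN0
  have hfd : f.natDegree = N.natDegree := natDegree_map _
  have hle : ∀ i, (EuclideanDomain.gcd (P i) f).natDegree ≤ N.natDegree := fun i =>
    hfd ▸ natDegree_le_of_dvd (EuclideanDomain.gcd_dvd_right _ _) hf0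
  have h1 := le_sum_natDegree_gcd hP N hN0 hdiv
  have h2 : ∑ _i : Fin m, N.natDegree = m * N.natDegree := by simp
  have h3 : ∑ i, (EuclideanDomain.gcd (P i) f).natDegree ≤ m * N.natDegree :=
    h2 ▸ Finset.sum_le_sum fun i _ => hle i
  have hmp : m = p := le_antisymm hm (Nat.le_of_mul_le_mul_right (h1.trans h3) hpos)
  refine ⟨hmp, fun i => ?_⟩
  -- Equality of the sums forces it term by term, so each gcd has the full degree of `N`.
  have heq : ∑ i, (EuclideanDomain.gcd (P i) f).natDegree = ∑ _i : Fin m, N.natDegree :=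
    le_antisymm (h3.trans h2.ge) (h2.trans_le ((congrArg (· * N.natDegree) hmp).trans_le h1))
  have hi := (Finset.sum_eq_sum_iff_of_le fun i _ => hle i).1 heq i (Finset.mem_univ i)
  have hass : Associated (EuclideanDomain.gcd (P i) f) f :=
    associated_of_dvd_of_natDegree_le (EuclideanDomain.gcd_dvd_right _ _) hf0 (by rw [hi, hfd])
  exact hass.symm.dvd.trans (EuclideanDomain.gcd_dvd_left _ _)

/-- If `N(∂ᵖ) R(∂ᵖ)` is a left multiple of `L = L' N(∂ᵖ)`, where `N` and `R` are coprime, then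
`L = LCLM(L', N(∂ᵖ))`. -/
theorem isLCLM_of_isCoprime {L' : DiffOp (RatFunc k)} {N R : (FrobField k p)[X]}
    (hNR : IsCoprime N R) (hL : L = L' * centralOp p N)
    (hmem : centralOp p (N * R) ∈ Submodule.span (DiffOp (RatFunc k)) {L}) :
    IsLCLM L L' (centralOp p N) := by
  have hmul : ∀ A B : (FrobField k p)[X], centralOp p (A * B) = centralOp p A * centralOp p B :=
    fun A B => by rw [centralOp_eq, Polynomial.map_mul, map_mul, ← centralOp_eq, ← centralOp_eq]
  apply le_antisymm
  · rw [Submodule.span_singleton_le_iff_mem]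
    refine ⟨Submodule.mem_span_singleton.2 ⟨centralOp p N, ?_⟩,
      Submodule.mem_span_singleton.2 ⟨L', hL.symm⟩⟩
    rw [smul_eq_mul, centralOp_mul_comm, hL]
  · rintro y ⟨h1, h2⟩
    obtain ⟨a, ha⟩ := Submodule.mem_span_singleton.1 h1
    obtain ⟨b, hb⟩ := Submodule.mem_span_singleton.1 h2
    obtain ⟨u, v, huv⟩ := hNR
    -- Here `y = aL' = bN(∂ᵖ)`. Centrality turns `N(∂ᵖ)y` into `aL`, and below `R(∂ᵖ)y` into
    -- `b(NR)(∂ᵖ)`.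
    have hNy : centralOp p N * y ∈ Submodule.span (DiffOp (RatFunc k)) {L} := by
      rw [← ha, smul_eq_mul, centralOp_mul_comm, mul_assoc, ← hL]
      exact Submodule.smul_mem _ _ (Submodule.mem_span_singleton_self _)
    have hRy : centralOp p R * y ∈ Submodule.span (DiffOp (RatFunc k)) {L} := by
      rw [← hb, smul_eq_mul, centralOp_mul_comm, mul_assoc, ← hmul]
      exact Submodule.smul_mem _ _ hmem
    have h : y = centralOp p u * (centralOp p N * y) + centralOp p v * (centralOp p R * y) := by
      rw [← mul_assoc, ← mul_assoc, ← hmul, ← hmul, ← add_mul]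
      have : centralOp p (u * N) + centralOp p (v * R) = 1 := by
        rw [centralOp_eq, centralOp_eq, ← map_add, ← Polynomial.map_add, huv, Polynomial.map_one,
          map_one]
      rw [this, one_mul]
    rw [h]
    exact add_mem (Submodule.smul_mem _ _ hNy) (Submodule.smul_mem _ _ hRy)

end DiffOp

end

/-! ### The three assertions of the lemma -/

open DiffOp in
theorem mainTheorem9 {k : Type*} [Field k] [Finite k] (p : ℕ) [Fact p.Prime] [CharP k p]
    (L : DiffOp (RatFunc k)) (hL : L ≠ 0)
    (hsep : DiffOp.SeparabilityHypothesis p L hL)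
    {m : ℕ} (P : Fin m → (RatFunc k)[X])
    (hP : IsFrobeniusInvariants (DiffOp.pCurvature p L) P)
    (N : (FrobField k p)[X]) (hNirr : Irreducible N) (hNsep : N.Separable)
    (ν : ℕ)
    (hν : IsGreatest {n : ℕ | DiffOp.IsRightDivisor (DiffOp.centralOp p N ^ n) L} ν) :
    ∃ Q : Fin m → (FrobField k p)[X],
      (∀ i, (Q i).map (algebraMap (FrobField k p) (RatFunc k)) = P i) ∧
      m ≤ p ∧
      (0 < ν → m = p ∧ ∀ i : Fin m, (i : ℕ) = 0 → emultiplicity N (Q i) = ν) ∧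
      ((∀ i : Fin m, (i : ℕ) + 1 = p → emultiplicity N (Q i) = ν) →
        ∀ L' : DiffOp (RatFunc k), L = L' * DiffOp.centralOp p N ^ ν →
          DiffOp.IsLCLM L L' (DiffOp.centralOp p N ^ ν)) := by
  choose Q hQ using IsFrobeniusInvariants.exists_map_eq hL hsep hP
  have hm := IsFrobeniusInvariants.card_le hP hQ
  have hdiv : IsRightDivisor (centralOp p (N ^ ν)) L := by
    rw [← centralOp_pow]; exact hν.1
  have key : 0 < ν → m = p ∧ ∀ i, N ^ ν ∣ Q i := by
    intro h
    have hpos : 0 < (N ^ ν).natDegree := by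
      rw [natDegree_pow]; exact Nat.mul_pos h hNirr.natDegree_pos
    obtain ⟨h1, h2⟩ := IsFrobeniusInvariants.card_eq_and_dvd hP hm _ hpos hdiv
    exact ⟨h1, fun i => (map_dvd_map' _).1 (by rw [hQ]; exact h2 i)⟩
  refine ⟨Q, hQ, hm, fun h => ⟨(key h).1, fun i hi => ?_⟩, fun h L' hL' => ?_⟩
  · obtain ⟨rfl, hd⟩ := key h
    refine emultiplicity_eq_coe.2 ⟨hd i, fun hd' => ?_⟩
    -- If `N^(ν+1)` divided the first invariant it would divide all `p` of them, and `N(∂ᵖ)^(ν+1)`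
    -- would divide `L`, against the maximality of `ν`.
    have hle : ν + 1 ≤ ν := hν.2 (by
      change IsRightDivisor _ L
      rw [centralOp_pow]
      refine IsFrobeniusInvariants.isRightDivisor hP _ (pow_ne_zero _ hNirr.ne_zero) fun j => ?_
      rw [← hQ, map_dvd_map']
      refine hd'.trans ((map_dvd_map' (algebraMap (FrobField k m) (RatFunc k))).1 ?_)
      rw [hQ, hQ]
      exact hP.dvd i j (Fin.le_def.2 (hi ▸ Nat.zero_le _)))
    omega
  -- For `ν = 0` the second operator is `1`, which generates the whole ring. This also covers `m <
  -- p`.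
  · rcases Nat.eq_zero_or_pos ν with rfl | hpos
    · rw [pow_zero, mul_one] at hL'
      have htop : Submodule.span (DiffOp (RatFunc k)) {(1 : DiffOp (RatFunc k))} = ⊤ := Ideal.span_singleton_one
      rw [IsLCLM, hL', pow_zero, htop, inf_top_eq]
    · obtain ⟨rfl, hd⟩ := key hpos
      have hm0 : 0 < m := (Fact.out : m.Prime).pos
      let l : Fin m := ⟨m - 1, by omega⟩
      obtain ⟨⟨R, hR⟩, hnd⟩ := emultiplicity_eq_coe.1 (h l (by change m - 1 + 1 = m; omega))
      rw [centralOp_pow] at hL' ⊢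
      refine isLCLM_of_isCoprime (R := R) (IsCoprime.pow_left ?_) hL' ?_
      · refine (hNirr.coprime_iff_not_dvd).2 fun hNR => hnd ?_
        rw [hR, pow_succ]
        exact mul_dvd_mul_left _ hNR
      -- The last invariant is a multiple of all the others, so it annihilates `𝒟_L`, in particular
      -- the class of `1`.
      · rw [← hR, centralOp_eq, hQ, ← mul_one (evalDelPow m (P l))]
        exact IsFrobeniusInvariants.mem_of_forall_dvd hP
          (fun i => hP.dvd i l (Fin.le_def.2 (by change (i : ℕ) ≤ m - 1; omega))) 1
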